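/- **Setting.** Let $X_1,X_2,\dots$ be random variables with values in a measurable space $\Xi$, defined on a probability space with probability $P$; write $\mathbf X_n=(X_1,\dots,X_n)$, and let $E_{\mathbf X_n}$ be the expectation under the law of $\mathbf X_n$ induced by the true $P$. The data are modelled by distributions $F_\theta$ of the whole sequence, $\theta\in\Theta=\prod_k\Theta_k$ (finitely or infinitely many coordinates, $(\Theta,\mathcal T)$ a measurable space); $P$ need not be one of them. For each $n$ the laws of $\mathbf X_n$ under $P$ and under all $F_\theta$ have densities $p$ and $f_\theta$ with respect to a common reference measure. Let $\pi$ be a prior probability on $\Theta$. Put $R_n(\theta)=f_\theta(\mathbf X_n)/p(\mathbf X_n)$, $h(\theta)=\lim_n \frac1n E_P\log\frac{p(\mathbf X_n)}{f_\theta(\mathbf X_n)}\in[0,\infty]$, $h(A)=\operatorname{ess\,inf}_{\theta\in A}h(\theta)$ (with respect to $\pi$), $J(\theta)=h(\theta)-h(\Theta)$, $J(A)=\operatorname{ess\,inf}_{\theta\in A}J(\theta)$, and $I=\{h=\infty\}$. Shalizi's conditions are assumed: * (S1) $R_n(\theta)$ is jointly measurable in $(\mathbf X_n,\theta)$. * (S2)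 For every $\theta$, almost surely $\frac1n\log R_n(\theta)\to-h(\theta)$. * (S3) For every $\theta$ the limit $h(\theta)$ exists, and $h$ is measurable. * (S4) $\pi(I)<1$. There are measurable sets $\mathcal G_n$, with every $\theta$ in $\mathcal G_n$ for all large $n$, such that: * (S5) (1) $\pi(\mathcal G_n)\ge 1-a e^{-\varsigma n}$ for some $a>0$ and $\varsigma>2h(\Theta)$. (2) Almost surely, as $n\to\infty$, the convergence in (S2) is uniform over $\mathcal G_n$, that is, $\sup_{\theta\in\mathcal G_n\setminus I}|\frac1n\log R_n(\theta)+h(\theta)|\to0$ and $\operatorname{ess\,sup}_{\theta\in\mathcal G_n\cap I}\frac1n\log R_n(\theta)\to-\infty$. (3) $h(\mathcal G_n)\to h(\Theta)$. * (S6) For every $\delta>0$, almost surely, for all large $n$ and all $k\ge n$: $\frac1k\log\int_{\mathcal G_n}R_k\,d\pi\le\delta+\limsup_{j\to\infty}\frac1j\log\int_{\mathcal G_n}R_j\,d\pi$. * (S7) $h(\mathcal G_n\cap A)\to h(A)$ for every measurable $A$ with $\pi(A)>0$. **Hypotheses, decisions and error measure.** For $m$ of the coordinates of $\theta$, numbered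 $i=1,\dots,m$, we test $H_{0i}:\theta_i\in\Theta_{0i}$ against $H_{1i}:\theta_i\notin\Theta_{0i}$, where the sets $\{\theta:\theta_i\in\Theta_{0i}\}$ are measurable; $H_{0i},H_{1i}$ also denote the corresponding subsets of $\Theta$. A decision configuration is $d\in\{0,1\}^m$, $d_i=1$ meaning that $H_{0i}$ is rejected. Put $\Theta(d)=\bigcap_i H_{d_i i}$. The true configuration $d^t$ is assumed to be the unique $d$ with $J(\Theta(d))=J(\Theta)$; let $m_0$ be the number of $i$ with $d_i^t=0$ (the true nulls), and assume $m_0<m$. For each $i$ let $G_i\subseteq\{1,\dots,m\}$ be an arbitrary group containing $i$ (possibly non-singleton, with no disjointness or other condition on the groups), and let $$v_{in}=\Pr(H_{1i}\mid\mathbf X_n),\qquad w_{in}(d)=\Pr\Big(H_{1i}\cap\bigcap_{j\in G_i,\,j\ne i}H_{d_j j}\,\Big|\,\mathbf X_n\Big)$$ be posterior probabilities. The additive-loss procedure with penalizing constant $\beta\in(0,1)$ uses the configuration $\hat d$ with $\hat d_i=1$ if $v_{in}>\beta$ and $\hat d_i=0$ otherwise (the minimizer of the posterior expectation of $c\sum_i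 d_i(1-r_i)+\sum_i(1-d_i)r_i$, where $\beta=c/(1+c)$ and $r_i=1_{H_{1i}}$), and $$mpBFDR_{\beta}=E_{\mathbf X_n}\Big[\frac{\sum_i\hat d_i\,(1-w_{in}(\hat d))}{\big(\sum_i\hat d_i\big)\vee1}\ \Big|\ \hat d\neq\mathbf 0\Big].$$ **Regularity.** Assume that $h(H_{1i})<\infty$ for every $i$ and that, for all large $n$, the distribution of each $v_{in}$ under $P$ has no atoms in $(0,1)$. **Theorem.** For every $\alpha$ with $0<\alpha<m_0/m$ there is a sequence $\beta_n\in(0,1)$ with $\beta_n\to0$ such that for the additive-loss procedure $$\lim_{n\to\infty}mpBFDR_{\beta_n}=\alpha .$$ -/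

import Mathlib

open MeasureTheory ProbabilityTheory Filter Topology Set
open scoped ENNReal NNReal

namespace BayesMT

noncomputable section

/-- A (possibly misspecified) Bayesian model for a sequence of observations.

* `P` is the probability on `Ω`; the observations `X 0, X 1, …` take values in `Ξ`, and their
  distribution under `P` is the true data-generating process.
* `law θ` is the postulated distribution of the whole sequence under the parameter `θ`.
* For each `n`, the true law and every postulated law of the first `n` observations have
  densities `p n` and `f n θ` with respect to the common reference measure `ref n`.
* `prior` is the prior distribution on the parameter space. -/
structure Model (Ω Ξ Θ : Type*) [MeasurableSpace Ω] [MeasurableSpace Ξ]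
    [MeasurableSpace Θ] where
  P : Measure Ω
  isProb_P : IsProbabilityMeasure P
  X : ℕ → Ω → Ξ
  measurable_X : ∀ n, Measurable (X n)
  law : Θ → Measure (ℕ → Ξ)
  isProb_law : ∀ θ, IsProbabilityMeasure (law θ)
  ref : ∀ n : ℕ, Measure (Fin n → Ξ)
  p : ∀ n : ℕ, (Fin n → Ξ) → ℝ≥0
  measurable_p : ∀ n, Measurable (p n)
  map_X : ∀ n, P.map (fun ω (k : Fin n) => X k ω) = (ref n).withDensity (fun x => (p n x : ℝ≥0∞))
  f : ∀ n : ℕ, Θ → (Fin n → Ξ) → ℝ≥0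
  measurable_f : ∀ n θ, Measurable (f n θ)
  map_law : ∀ n θ, (law θ).map (fun x (k : Fin n) => x k) =
    (ref n).withDensity (fun x => (f n θ x : ℝ≥0∞))
  prior : Measure Θ
  isProb_prior : IsProbabilityMeasure prior

namespace Model

variable {Ω Ξ Θ : Type*} [MeasurableSpace Ω] [MeasurableSpace Ξ] [MeasurableSpace Θ]
  (M : Model Ω Ξ Θ) {m : ℕ}

/-- The data vector made of the first `n` observations. -/
def data (n : ℕ) (ω : Ω) : Fin n → Ξ := fun k => M.X k ω

/-- The true law of the first `n` observations. -/
def dataLaw (n : ℕ) : Measure (Fin n → Ξ) := M.P.map (M.data n)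

/-- The postulated law of the first `n` observations under `θ`. -/
def postulatedLaw (n : ℕ) (θ : Θ) : Measure (Fin n → Ξ) :=
  (M.law θ).map (fun x (k : Fin n) => x k)

/-- The likelihood ratio `R_n(θ) = f_θ(x) / p(x)`. -/
def R (n : ℕ) (θ : Θ) (x : Fin n → Ξ) : ℝ≥0∞ := (M.f n θ x : ℝ≥0∞) / (M.p n x : ℝ≥0∞)

/-- The Kullback-Leibler divergence rate `h(θ)` of the true process from the postulated one
(`KLRateExists` below says that the upper limit is a limit). -/
def h (θ : Θ) : ℝ≥0∞ :=
  limsup (fun n : ℕ => InformationTheory.klDiv (M.dataLaw n) (M.postulatedLaw n θ) / (n : ℝ≥0∞))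
    atTop

/-- The divergence rate is a limit for every parameter. -/
def KLRateExists : Prop :=
  ∀ θ, Tendsto
    (fun n : ℕ => InformationTheory.klDiv (M.dataLaw n) (M.postulatedLaw n θ) / (n : ℝ≥0∞))
    atTop (𝓝 (M.h θ))

/-- `h(A)`, the essential infimum of `h` over `A` with respect to the prior. -/
def hOn (A : Set Θ) : ℝ≥0∞ := essInf M.h (M.prior.restrict A)

/-- `J(θ) = h(θ) - h(Θ)`. -/
def J (θ : Θ) : ℝ≥0∞ := M.h θ - M.hOn univ

/-- `J(A)`, the essential infimum of `J` over `A` with respect to the prior. -/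
def JOn (A : Set Θ) : ℝ≥0∞ := essInf M.J (M.prior.restrict A)

/-- `n⁻¹ log R_n(θ)` along the observed sequence. -/
def logRatioRate (n : ℕ) (θ : Θ) (ω : Ω) : EReal :=
  ENNReal.log (M.R n θ (M.data n ω)) / ((n : ℝ) : EReal)

/-- `n⁻¹ log ∫_A R_n(θ) dπ(θ)` along the observed sequence. -/
def logIntegralRate (A : Set Θ) (n : ℕ) (ω : Ω) : EReal :=
  ENNReal.log (∫⁻ θ in A, M.R n θ (M.data n ω) ∂M.prior) / ((n : ℝ) : EReal)

/-- Shalizi's conditions on the model and the prior. -/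
structure Shalizi : Prop where
  /-- (S1) joint measurability of the likelihood ratio -/
  measurable_R : ∀ n, Measurable (fun q : Θ × (Fin n → Ξ) => M.R n q.1 q.2)
  /-- (S2) the relative asymptotic equipartition property -/
  aep : ∀ θ, ∀ᵐ ω ∂M.P, Tendsto (fun n => M.logRatioRate n θ ω) atTop (𝓝 (-(M.h θ : EReal)))
  /-- (S3) existence and measurability of the divergence rate -/
  klRateExists : M.KLRateExists
  measurable_h : Measurable M.h
  /-- (S4) the prior does not charge only parameters of infinite divergence rate -/
  prior_infinite_lt : M.prior {θ | M.h θ = ∞} < 1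
  /-- (S5)-(S7) existence of suitable sieves `𝒢 n` -/
  sieves : ∃ 𝒢 : ℕ → Set Θ,
    (∀ n, MeasurableSet (𝒢 n)) ∧
    (∀ θ, ∀ᶠ n in atTop, θ ∈ 𝒢 n) ∧
    -- (S5)(1): exponentially small prior mass outside the sieves
    (∃ a ς : ℝ, 0 < a ∧ 2 * M.hOn univ < ENNReal.ofReal ς ∧
      ∀ n : ℕ, 1 - a * Real.exp (-ς * n) ≤ M.prior.real (𝒢 n)) ∧
    -- (S5)(2): the equipartition convergence is uniform over the sieves, at finite `h` ...
    (∀ᵐ ω ∂M.P, ∀ ε : ℝ, 0 < ε → ∀ᶠ n in atTop, ∀ θ ∈ 𝒢 n, M.h θ ≠ ∞ →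
      -(M.h θ : EReal) - (ε : EReal) ≤ M.logRatioRate n θ ω ∧
        M.logRatioRate n θ ω ≤ -(M.h θ : EReal) + (ε : EReal)) ∧
    -- ... and, up to a set of prior probability zero, at infinite `h`
    (∀ᵐ ω ∂M.P, ∀ c : ℝ, ∀ᶠ n in atTop, ∀ᵐ θ ∂M.prior, θ ∈ 𝒢 n → M.h θ = ∞ →
      M.logRatioRate n θ ω ≤ (c : EReal)) ∧
    -- (S5)(3)
    Tendsto (fun n => M.hOn (𝒢 n)) atTop (𝓝 (M.hOn univ)) ∧
    -- (S6): `n > τ(𝒢 n, δ)` for all large `n`, where `τ(A, δ)` is the least time after which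
    -- `n⁻¹ log ∫_A R_n dπ` stays below `δ` plus its upper limit
    (∀ δ : ℝ, 0 < δ → ∀ᵐ ω ∂M.P, ∀ᶠ n in atTop, ∀ k ≥ n,
      M.logIntegralRate (𝒢 n) k ω ≤
        (δ : EReal) + limsup (fun j => M.logIntegralRate (𝒢 n) j ω) atTop) ∧
    -- (S7)
    (∀ A, MeasurableSet A → 0 < M.prior A →
      Tendsto (fun n => M.hOn (𝒢 n ∩ A)) atTop (𝓝 (M.hOn A)))

/-- The posterior distribution given the data `x`, by Bayes' formula. -/
def posterior (n : ℕ) (x : Fin n → Ξ) : Measure Θ :=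
  (∫⁻ θ, (M.f n θ x : ℝ≥0∞) ∂M.prior)⁻¹ • M.prior.withDensity (fun θ => (M.f n θ x : ℝ≥0∞))

/-! Below, `H i` is the set of parameters satisfying the `i`-th null hypothesis, its complement
being the alternative; a decision configuration `d` rejects the null hypotheses with
`d i = true`; and `G i` is the group of the `i`-th hypothesis. -/

/-- `v_{in}`, the posterior probability of the `i`-th alternative. -/
def v (H : Fin m → Set Θ) (n : ℕ) (x : Fin n → Ξ) (i : Fin m) : ℝ :=
  (M.posterior n x).real (H i)ᶜ

/-- `w_{in}(d)`, the posterior probability that the `i`-th alternative is true and all the other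
decisions of `d` in the group of `i` are correct. -/
def w (H : Fin m → Set Θ) (G : Fin m → Finset (Fin m)) (n : ℕ) (x : Fin n → Ξ)
    (d : Fin m → Bool) (i : Fin m) : ℝ :=
  (M.posterior n x).real {θ | θ ∉ H i ∧ ∀ j ∈ G i, j ≠ i → (d j = true ↔ θ ∉ H j)}

/-- The modified posterior FDR given the data `x` of the procedure that chooses the configuration
`d` with probability `δ d`. -/
def modifiedFDR (H : Fin m → Set Θ) (G : Fin m → Finset (Fin m)) (n : ℕ) (x : Fin n → Ξ)
    (δ : (Fin m → Bool) → ℝ) : ℝ :=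
  ∑ d : Fin m → Bool,
    (∑ i, if d i = true then 1 - M.w H G n x d i else 0) /
      max (∑ i, if d i = true then (1 : ℝ) else 0) 1 * δ d

/-- The modified positive Bayesian FDR: the expectation of the modified posterior FDR under the
true law of the data, conditionally on the event that some hypothesis is rejected. -/
def mpBFDR (H : Fin m → Set Θ) (G : Fin m → Finset (Fin m)) (n : ℕ)
    (δ : (Fin n → Ξ) → (Fin m → Bool) → ℝ) : ℝ :=
  ∫ x, M.modifiedFDR H G n x (δ x)
    ∂(ProbabilityTheory.cond (M.dataLaw n) {x | δ x (fun _ => false) = 0})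

/-- The decision configuration of the additive-loss procedure with penalizing constant `β`:
reject the `i`-th null hypothesis exactly when `v_{in} > β`. -/
def additiveDecision (H : Fin m → Set Θ) (n : ℕ) (β : ℝ) (x : Fin n → Ξ) : Fin m → Bool :=
  fun i => decide (β < M.v H n x i)

/-- The additive-loss procedure as a (non-randomized) procedure. -/
def additiveProcedure (H : Fin m → Set Θ) (n : ℕ) (β : ℝ) (x : Fin n → Ξ)
    (d : Fin m → Bool) : ℝ :=
  if d = M.additiveDecision H n β x then 1 else 0

/-- With `β = c / (1 + c)`, the configuration above minimizes the posterior expectation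
`c ∑ d_i (1 - v_i) + ∑ (1 - d_i) v_i` of the additive loss. -/
theorem additiveDecision_minimizes (H : Fin m → Set Θ) (n : ℕ) (x : Fin n → Ξ) (c : ℝ)
    (hc : 0 < c) (d : Fin m → Bool) :
    (∑ i, if M.additiveDecision H n (c / (1 + c)) x i = true
        then c * (1 - M.v H n x i) else M.v H n x i) ≤
      ∑ i, if d i = true then c * (1 - M.v H n x i) else M.v H n x i := by
  refine Finset.sum_le_sum fun i _ => ?_
  have h1 : (c / (1 + c) < M.v H n x i) ↔ c < M.v H n x i * (1 + c) :=
    div_lt_iff₀ (by linarith)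
  simp only [additiveDecision, decide_eq_true_eq, h1]
  split_ifs <;> nlinarith

end Model

/-- The parameter set `Θ(d)` on which exactly the decisions of `d` are correct. -/
def configRegion {Θ : Type*} {m : ℕ} (H : Fin m → Set Θ) (d : Fin m → Bool) : Set Θ :=
  {θ | ∀ i, (d i = true ↔ θ ∉ H i)}

/-- The number of null hypotheses not rejected by `d`. -/
def numNulls {m : ℕ} (d : Fin m → Bool) : ℕ :=
  (Finset.univ.filter (fun i => d i = false)).card

end

end BayesMT

/-!
The threshold `β n` is found by the intermediate value theorem between two regimes, at each large
sample size `n`.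

*Posterior behaviour.* The posterior probability of a set `A` is the quotient of the integrals of
the likelihood ratio over `A` and over the whole space. By Fubini, the pointwise equipartition
property and Fatou's lemma, the integral over a set of divergence rate below `c` is eventually at
least `exp (-c n)` (`ae_eventually_le_setLIntegral_R`). An upper bound comes from the sieves: inside
them the equipartition property is uniform, and outside them the integral has expectation at most
the prior mass, which is exponentially small at a rate exceeding the minimal divergence rate. Hence
sets of non-minimal divergence rate lose all posterior mass (`ae_tendsto_posterior_zero`), and the
posterior concentrates on the region of the true configuration
(`ae_tendsto_posterior_compl_configRegion`).

*Fixed thresholds.* For fixed `β ∈ (0, 1)` the procedure eventually takes exactly the true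
decisions; so its error measure tends to `0`, and the probability of rejecting something tends to
`1` (`tendsto_meanFDR_zero`, `tendsto_rejectProb_one`).

*Vanishing thresholds.* For fixed `n`, letting `β` decrease to `0` yields the procedure with
threshold `0`, which rejects every hypothesis whose alternative has positive posterior probability.
As alternatives have finite divergence rate, for large `n` these are all the hypotheses, and the
true nulls alone contribute about `m₀ / m > α` to the posterior FDR (`eventually_lt_meanFDR_zero`).

Since the posterior probabilities of the alternatives have no atoms in `(0, 1)`, the error measure
is continuous in `β`. It therefore takes the value `α` at arbitrarily small `β` for large `n`
(`eventually_exists_mpBFDR_eq`), and the solutions can be chosen to tend to `0`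
(`exists_seq_tendsto_zero_of_eventually_exists_eq`).
-/

namespace BayesMT.Model

variable {Ω Ξ Θ : Type*} [MeasurableSpace Ω] [MeasurableSpace Ξ] [MeasurableSpace Θ]
  {M : Model Ω Ξ Θ}

/-! ### The likelihood ratio and the posterior distribution -/

instance : IsProbabilityMeasure M.P := M.isProb_P

instance : IsProbabilityMeasure M.prior := M.isProb_prior

lemma measurable_data (n : ℕ) : Measurable (M.data n) :=
  measurable_pi_lambda _ fun k => M.measurable_X k

instance (n : ℕ) : IsProbabilityMeasure (M.dataLaw n) :=
  Measure.isProbabilityMeasure_map (measurable_data n).aemeasurable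

lemma ae_p_ne_zero (n : ℕ) : ∀ᵐ x ∂M.dataLaw n, M.p n x ≠ 0 := by
  have h : M.dataLaw n = (M.ref n).withDensity (fun x => (M.p n x : ℝ≥0∞)) := M.map_X n
  rw [h, ae_withDensity_iff (M.measurable_p n).coe_nnreal_ennreal]
  exact ae_of_all _ fun x hx => by simpa using hx

lemma ae_data_p_ne_zero (n : ℕ) : ∀ᵐ ω ∂M.P, M.p n (M.data n ω) ≠ 0 :=
  ae_of_ae_map (measurable_data n).aemeasurable (ae_p_ne_zero n)

/-- The likelihood ratio has expectation at most `1` under the truth; it is smaller than `1` when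
the postulated law charges the set where the true density vanishes. -/
lemma lintegral_R_le_one (n : ℕ) (θ : Θ) : ∫⁻ x, M.R n θ x ∂M.dataLaw n ≤ 1 := by
  have h : M.dataLaw n = (M.ref n).withDensity (fun x => (M.p n x : ℝ≥0∞)) := M.map_X n
  have hp := (M.measurable_p n).coe_nnreal_ennreal
  have hf := (M.measurable_f n θ).coe_nnreal_ennreal
  rw [h, lintegral_withDensity_eq_lintegral_mul _ hp (g := M.R n θ) (hf.div hp)]
  calc ∫⁻ x, ((fun x => (M.p n x : ℝ≥0∞)) * M.R n θ) x ∂M.ref n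
      ≤ ∫⁻ x, (M.f n θ x : ℝ≥0∞) ∂M.ref n := lintegral_mono fun x => ENNReal.mul_div_le
    _ = (M.law θ).map (fun x (k : Fin n) => x k) univ := by
        rw [M.map_law, withDensity_apply _ MeasurableSet.univ, Measure.restrict_univ]
    _ ≤ 1 := by
        have := M.isProb_law θ
        have := Measure.isProbabilityMeasure_map (μ := M.law θ)
          (f := fun x (k : Fin n) => x k)
          (measurable_pi_lambda _ fun k => measurable_pi_apply _).aemeasurable
        exact prob_le_one

lemma posterior_apply {n : ℕ} {x : Fin n → Ξ} (hx : M.p n x ≠ 0) {A : Set Θ}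
    (hA : MeasurableSet A) :
    M.posterior n x A = (∫⁻ θ, M.R n θ x ∂M.prior)⁻¹ * ∫⁻ θ in A, M.R n θ x ∂M.prior := by
  have h0 : (M.p n x : ℝ≥0∞) ≠ 0 := by simpa using hx
  have h1 : (M.p n x : ℝ≥0∞)⁻¹ ≠ ∞ := by simpa using hx
  have h2 : (M.p n x : ℝ≥0∞)⁻¹ ≠ 0 := by simp
  simp only [posterior, Measure.smul_apply, withDensity_apply _ hA, smul_eq_mul, R, div_eq_mul_inv]
  rw [lintegral_mul_const' _ _ h1, lintegral_mul_const' _ _ h1,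
    ENNReal.mul_inv (Or.inr h1) (Or.inr h2), inv_inv, mul_mul_mul_comm,
    ENNReal.mul_inv_cancel h0 (by simp), mul_one]

lemma posterior_univ_le_one (n : ℕ) (x : Fin n → Ξ) : M.posterior n x univ ≤ 1 := by
  simp only [posterior, Measure.smul_apply, withDensity_apply _ MeasurableSet.univ, smul_eq_mul,
    Measure.restrict_univ]
  exact ENNReal.inv_mul_le_one _

instance (n : ℕ) (x : Fin n → Ξ) : IsFiniteMeasure (M.posterior n x) :=
  ⟨(posterior_univ_le_one n x).trans_lt ENNReal.one_lt_top⟩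

lemma posterior_real_le_one (n : ℕ) (x : Fin n → Ξ) (A : Set Θ) :
    (M.posterior n x).real A ≤ 1 :=
  ENNReal.toReal_le_of_le_ofReal zero_le_one
    (by simpa using (measure_mono (subset_univ A)).trans (posterior_univ_le_one n x))

lemma le_R_of_le_logRatioRate {n : ℕ} (hn : 0 < n) {θ : Θ} {ω : Ω} {q : ℝ}
    (h : (q : EReal) ≤ M.logRatioRate n θ ω) :
    ENNReal.ofReal (Real.exp (q * n)) ≤ M.R n θ (M.data n ω) := by
  have hn' : (0 : EReal) < ((n : ℝ) : EReal) := by exact_mod_cast hn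
  rw [logRatioRate, EReal.le_div_iff_mul_le hn' (EReal.coe_ne_top _), ← EReal.coe_mul] at h
  have := EReal.exp_monotone h
  rwa [ENNReal.exp_log, EReal.exp_coe] at this

lemma R_le_of_logRatioRate_le {n : ℕ} (hn : 0 < n) {θ : Θ} {ω : Ω} {q : ℝ}
    (h : M.logRatioRate n θ ω ≤ (q : EReal)) :
    M.R n θ (M.data n ω) ≤ ENNReal.ofReal (Real.exp (q * n)) := by
  have hn' : (0 : EReal) < ((n : ℝ) : EReal) := by exact_mod_cast hn
  rw [logRatioRate, EReal.div_le_iff_le_mul hn' (EReal.coe_ne_top _), ← EReal.coe_mul] at h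
  have := EReal.exp_monotone h
  rwa [ENNReal.exp_log, EReal.exp_coe, mul_comm] at this

namespace Shalizi

variable (hM : M.Shalizi)
include hM

lemma measurable_R_data (n : ℕ) : Measurable fun q : Θ × Ω => M.R n q.1 (M.data n q.2) :=
  (hM.measurable_R n).comp (measurable_fst.prodMk ((measurable_data n).comp measurable_snd))

lemma measurable_R_param (n : ℕ) (x : Fin n → Ξ) : Measurable fun θ => M.R n θ x :=
  (hM.measurable_R n).comp (measurable_id.prodMk measurable_const)

lemma measurable_lintegral_R (n : ℕ) (A : Set Θ) :
    Measurable fun x : Fin n → Ξ => ∫⁻ θ in A, M.R n θ x ∂M.prior :=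
  (hM.measurable_R n).lintegral_prod_left'

lemma measurable_lintegral_R_data (n : ℕ) (A : Set Θ) :
    Measurable fun ω => ∫⁻ θ in A, M.R n θ (M.data n ω) ∂M.prior :=
  (hM.measurable_lintegral_R n A).comp (measurable_data n)

lemma aemeasurable_posterior_real (n : ℕ) {A : Set Θ} (hA : MeasurableSet A) :
    AEMeasurable (fun x => (M.posterior n x).real A) (M.dataLaw n) := by
  have hZ : Measurable fun x : Fin n → Ξ => ∫⁻ θ, M.R n θ x ∂M.prior := by
    simpa using hM.measurable_lintegral_R n univ
  refine ⟨fun x => ((∫⁻ θ, M.R n θ x ∂M.prior)⁻¹ * ∫⁻ θ in A, M.R n θ x ∂M.prior).toReal,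
    (hZ.inv.mul (hM.measurable_lintegral_R n A)).ennreal_toReal, ?_⟩
  filter_upwards [ae_p_ne_zero n] with x hx
  rw [Measure.real, posterior_apply hx hA]

lemma lintegral_setLIntegral_R_le (n : ℕ) (A : Set Θ) :
    ∫⁻ ω, ∫⁻ θ in A, M.R n θ (M.data n ω) ∂M.prior ∂M.P ≤ M.prior A := by
  have hm : AEMeasurable (Function.uncurry fun ω θ => M.R n θ (M.data n ω))
      (M.P.prod (M.prior.restrict A)) :=
    ((hM.measurable_R_data n).comp measurable_swap).aemeasurable
  rw [lintegral_lintegral_swap hm]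
  calc ∫⁻ θ in A, ∫⁻ ω, M.R n θ (M.data n ω) ∂M.P ∂M.prior
      ≤ ∫⁻ θ in A, 1 ∂M.prior := by
        refine lintegral_mono fun θ => ?_
        have h := lintegral_R_le_one (M := M) n θ
        have hR : Measurable fun x : Fin n → Ξ => M.R n θ x :=
          (hM.measurable_R n).comp (measurable_const.prodMk measurable_id)
        rwa [dataLaw, lintegral_map hR (measurable_data n)] at h
    _ = M.prior A := by simp

/-! ### Exponential bounds for integrated likelihood ratios -/

/-- The integrated likelihood ratio over sets of exponentially small prior mass is almost surely
exponentially small, since its expectation is at most the prior mass. -/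
lemma ae_eventually_setLIntegral_R_le {A : ℕ → Set Θ} {a s s' : ℝ} (hs : s' < s)
    (hA : ∀ n : ℕ, M.prior (A n) ≤ ENNReal.ofReal (a * Real.exp (-s * n))) :
    ∀ᵐ ω ∂M.P, ∀ᶠ n : ℕ in atTop, ∫⁻ θ in A n, M.R n θ (M.data n ω) ∂M.prior ≤
      ENNReal.ofReal (Real.exp (-s' * n)) := by
  set Y : ℕ → Ω → ℝ≥0∞ := fun n ω => ENNReal.ofReal (Real.exp (s' * n)) *
    ∫⁻ θ in A n, M.R n θ (M.data n ω) ∂M.prior with hY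
  have hYm : ∀ n, Measurable (Y n) := fun n => (hM.measurable_lintegral_R_data n _).const_mul _
  have hYint : ∀ n, ∫⁻ ω, Y n ω ∂M.P ≤ ENNReal.ofReal (|a| * Real.exp (-(s - s')) ^ n) := by
    intro n
    rw [hY, lintegral_const_mul _ (hM.measurable_lintegral_R_data n _)]
    calc _ ≤ ENNReal.ofReal (Real.exp (s' * n)) * ENNReal.ofReal (a * Real.exp (-s * n)) := by
          gcongr
          exact (hM.lintegral_setLIntegral_R_le n _).trans (hA n)
      _ = ENNReal.ofReal (a * Real.exp (-(s - s')) ^ n) := by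
          rw [← ENNReal.ofReal_mul (Real.exp_pos _).le, ← Real.exp_nat_mul, mul_left_comm,
            ← Real.exp_add]
          ring_nf
      _ ≤ _ := by gcongr; exact le_abs_self a
  have hsum : ∑' n, ∫⁻ ω, Y n ω ∂M.P ≠ ∞ := by
    have hgeom : Summable fun n : ℕ => |a| * Real.exp (-(s - s')) ^ n :=
      (summable_geometric_of_lt_one (Real.exp_pos _).le
        (by rw [Real.exp_lt_one_iff]; linarith)).mul_left _
    refine ne_top_of_le_ne_top ?_ (ENNReal.tsum_le_tsum hYint)
    exact hgeom.tsum_ofReal_ne_top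
  rw [← lintegral_tsum fun n => (hYm n).aemeasurable] at hsum
  filter_upwards [ae_lt_top (Measurable.tsum hYm) hsum] with ω hω
  have h0 := ENNReal.tendsto_atTop_zero_of_tsum_ne_top hω.ne
  filter_upwards [h0.eventually_le_const one_pos] with n hn
  have h1 : ENNReal.ofReal (Real.exp (-s' * n)) = (ENNReal.ofReal (Real.exp (s' * n)))⁻¹ := by
    rw [← ENNReal.ofReal_inv_of_pos (Real.exp_pos _), ← Real.exp_neg, neg_mul]
  rw [h1, ENNReal.le_inv_iff_mul_le, mul_comm]
  exact hn

/-- By Fubini, the equipartition property holds almost surely at almost every parameter. -/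
lemma ae_ae_tendsto_logRatioRate :
    ∀ᵐ ω ∂M.P, ∀ᵐ θ ∂M.prior,
      Tendsto (fun n => M.logRatioRate n θ ω) atTop (𝓝 (-(M.h θ : EReal))) := by
  have hmeas : MeasurableSet {q : Θ × Ω |
      Tendsto (fun n => M.logRatioRate n q.1 q.2) atTop (𝓝 (-(M.h q.1 : EReal)))} := by
    refine measurableSet_tendsto_fun (fun n => ?_) ?_
    · exact (EReal.monotone_div_right_of_nonneg (by positivity)).measurable.comp
        (hM.measurable_R_data n).ennreal_log
    · exact (hM.measurable_h.comp measurable_fst).coe_ereal_ennreal.neg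
  exact (Measure.ae_ae_comm
    (p := fun θ ω => Tendsto (fun n => M.logRatioRate n θ ω) atTop (𝓝 (-(M.h θ : EReal))))
    hmeas).1 (ae_of_all _ hM.aep)

/-- The integrated likelihood ratio over a set of divergence rate less than `c` almost surely does
not decay faster than `exp (-c n)`. -/
lemma ae_eventually_le_setLIntegral_R {A : Set Θ} (hA : MeasurableSet A) {c : ℝ}
    (hc : M.hOn A < ENNReal.ofReal c) :
    ∀ᵐ ω ∂M.P, ∀ᶠ n : ℕ in atTop, ENNReal.ofReal (Real.exp (-c * n)) ≤
      ∫⁻ θ in A, M.R n θ (M.data n ω) ∂M.prior := by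
  set B : Set Θ := A ∩ {θ | M.h θ < ENNReal.ofReal c} with hB
  have hBm : MeasurableSet B := hA.inter (measurableSet_lt hM.measurable_h measurable_const)
  have hB0 : M.prior B ≠ 0 := by
    intro h0
    refine hc.not_ge (le_essInf_of_ae_le _ ?_)
    rw [EventuallyLE, ae_restrict_iff' hA]
    filter_upwards [measure_eq_zero_iff_ae_notMem.1 h0] with θ hθ hθA
    exact not_lt.1 fun h => hθ ⟨hθA, h⟩
  filter_upwards [hM.ae_ae_tendsto_logRatioRate] with ω hω
  set g : ℕ → Θ → ℝ≥0∞ := fun n θ => ENNReal.ofReal (Real.exp (c * n)) *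
    M.R n θ (M.data n ω) with hg
  -- Rescaled by `exp (c n)`, the likelihood ratio diverges at almost every point of `B`.
  have hlim : ∀ᵐ θ ∂M.prior.restrict B, liminf (fun n => g n θ) atTop = ∞ := by
    rw [ae_restrict_iff' hBm]
    filter_upwards [hω] with θ hθ hθB
    refine Tendsto.liminf_eq ?_
    have hlt : ((-c : ℝ) : EReal) < -(M.h θ : EReal) := by
      rw [EReal.coe_neg, EReal.neg_lt_neg_iff]
      have h1 : M.h θ < ENNReal.ofReal c := hθB.2
      have hc0 : 0 < c := ENNReal.ofReal_pos.1 (pos_of_gt h1)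
      have h2 : (M.h θ : EReal) < ((ENNReal.ofReal c : ℝ≥0∞) : EReal) :=
        EReal.coe_ennreal_lt_coe_ennreal_iff.2 h1
      rwa [EReal.coe_ennreal_ofReal, max_eq_left hc0.le] at h2
    obtain ⟨q, hq1, hq2⟩ := EReal.lt_iff_exists_real_btwn.1 hlt
    have hq1' : -c < q := by exact_mod_cast hq1
    have hexp : Tendsto (fun n : ℕ => ENNReal.ofReal (Real.exp ((c + q) * n))) atTop (𝓝 ∞) :=
      ENNReal.tendsto_ofReal_nhds_top.2 (Real.tendsto_exp_atTop.comp
        (tendsto_natCast_atTop_atTop.const_mul_atTop (by linarith)))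
    refine tendsto_nhds_top_mono hexp ?_
    filter_upwards [hθ.eventually_const_le hq2, eventually_gt_atTop 0] with n hn hn0
    calc ENNReal.ofReal (Real.exp ((c + q) * n))
        = ENNReal.ofReal (Real.exp (c * n)) * ENNReal.ofReal (Real.exp (q * n)) := by
          rw [← ENNReal.ofReal_mul (Real.exp_pos _).le, ← Real.exp_add]; ring_nf
      _ ≤ g n θ :=
          mul_le_mul_right (le_R_of_le_logRatioRate hn0 hn) _
  have hfatou := lintegral_liminf_le (μ := M.prior.restrict B) (f := g) (u := atTop)
    (fun n => (hM.measurable_R_param n _).const_mul _)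
  rw [lintegral_congr_ae hlim, lintegral_const, Measure.restrict_apply_univ,
    ENNReal.top_mul hB0, top_le_iff] at hfatou
  -- By Fatou's lemma the rescaled integrals diverge, so they eventually exceed `1`.
  have h1 : (1 : ℝ≥0∞) < liminf (fun n => ∫⁻ θ in B, g n θ ∂M.prior) atTop := by
    rw [hfatou]; exact ENNReal.one_lt_top
  filter_upwards [eventually_lt_of_lt_liminf h1] with n hn
  rw [hg, lintegral_const_mul _ (hM.measurable_R_param n _)] at hn
  have h2 : ENNReal.ofReal (Real.exp (-c * n)) = (ENNReal.ofReal (Real.exp (c * n)))⁻¹ := by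
    rw [← ENNReal.ofReal_inv_of_pos (Real.exp_pos _), ← Real.exp_neg, neg_mul]
  rw [h2]
  refine le_trans ?_ (lintegral_mono_set (inter_subset_left : B ⊆ A))
  rw [ENNReal.inv_le_iff_le_mul (fun _ => by simp [Real.exp_pos]) (fun h => absurd h (by simp))]
  exact hn.le

end Shalizi
end BayesMT.Model

namespace BayesMT.Model

variable {Ω Ξ Θ : Type*} [MeasurableSpace Ω] [MeasurableSpace Ξ] [MeasurableSpace Θ]
  {M : Model Ω Ξ Θ}

/-! ### Posterior consistency -/

lemma ae_lt_h_of_lt_hOn {A : Set Θ} (hA : MeasurableSet A) {c : ℝ≥0∞} (hc : c < M.hOn A) :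
    ∀ᵐ θ ∂M.prior, θ ∈ A → c < M.h θ := by
  rw [← ae_restrict_iff' hA]
  exact ae_lt_of_lt_essInf hc

/-- On the sieves, the uniform equipartition property bounds the integrated likelihood ratio over
a set of divergence rate more than `c`. -/
lemma eventually_setLIntegral_inter_R_le {𝒢 : ℕ → Set Θ} (h𝒢 : ∀ n, MeasurableSet (𝒢 n)) {ω : Ω}
    (hfin : ∀ ε : ℝ, 0 < ε → ∀ᶠ n in atTop, ∀ θ ∈ 𝒢 n, M.h θ ≠ ∞ →
      M.logRatioRate n θ ω ≤ -(M.h θ : EReal) + (ε : EReal))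
    (hinf : ∀ c : ℝ, ∀ᶠ n in atTop, ∀ᵐ θ ∂M.prior, θ ∈ 𝒢 n → M.h θ = ∞ →
      M.logRatioRate n θ ω ≤ (c : EReal))
    {A : Set Θ} (hA : MeasurableSet A) {c : ℝ} (hc0 : 0 ≤ c) (hc : ENNReal.ofReal c < M.hOn A) :
    ∀ᶠ n : ℕ in atTop, ∫⁻ θ in 𝒢 n ∩ A, M.R n θ (M.data n ω) ∂M.prior ≤
      ENNReal.ofReal (Real.exp (-c * n)) := by
  obtain ⟨c', hc1, hc2⟩ := ENNReal.lt_iff_exists_nnreal_btwn.1 hc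
  have hcc : c < c' := by
    rwa [← ENNReal.ofReal_coe_nnreal, ENNReal.ofReal_lt_ofReal_iff_of_nonneg hc0] at hc1
  filter_upwards [hfin (c' - c) (by linarith), hinf (-c), eventually_gt_atTop 0]
    with n hn1 hn2 hn0
  have hle : ∀ᵐ θ ∂M.prior.restrict (𝒢 n ∩ A),
      M.R n θ (M.data n ω) ≤ ENNReal.ofReal (Real.exp (-c * n)) := by
    rw [ae_restrict_iff' ((h𝒢 n).inter hA)]
    filter_upwards [hn2, ae_lt_h_of_lt_hOn hA hc2] with θ hθ2 hθc hθ
    refine R_le_of_logRatioRate_le hn0 ?_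
    by_cases hθi : M.h θ = ∞
    · exact hθ2 hθ.1 hθi
    refine (hn1 θ hθ.1 hθi).trans ?_
    lift M.h θ to ℝ≥0 using hθi with y hy
    have hy' : (c' : ℝ) < y := by
      exact_mod_cast hθc hθ.2
    have : -(y : ℝ) + (c' - c) ≤ -c := by linarith
    rw [EReal.coe_nnreal_eq_coe_real, ← EReal.coe_neg, ← EReal.coe_add]
    exact EReal.coe_le_coe_iff.2 this
  calc _ ≤ ∫⁻ θ in 𝒢 n ∩ A, ENNReal.ofReal (Real.exp (-c * n)) ∂M.prior := lintegral_mono_ae hle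
    _ ≤ _ := by
      rw [lintegral_const, Measure.restrict_apply_univ]
      exact mul_le_of_le_one_right' prob_le_one

lemma measurableSet_configRegion {m : ℕ} {H : Fin m → Set Θ} (hH : ∀ i, MeasurableSet (H i))
    (d : Fin m → Bool) : MeasurableSet (configRegion H d) := by
  have : configRegion H d = ⋂ i, if d i = true then (H i)ᶜ else H i := by
    ext θ
    simp only [configRegion, mem_ofPred_eq, mem_iInter]
    refine forall_congr' fun i => ?_
    cases d i <;> simp
  rw [this]
  refine MeasurableSet.iInter fun i => ?_
  split_ifs
  exacts [(hH i).compl, hH i]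

namespace Shalizi

variable (hM : M.Shalizi)
include hM

lemma hOn_univ_ne_top : M.hOn univ ≠ ∞ := by
  obtain ⟨𝒢, -, -, ⟨a, ς, -, hς, -⟩, -⟩ := hM.sieves
  intro h
  rw [h, ENNReal.mul_top two_ne_zero] at hς
  exact not_top_lt hς

/-- Posterior consistency: the posterior probability of a set whose divergence rate exceeds the
minimal one tends to `0` almost surely. The normalizing constant decays at most at the minimal
rate; the integral over the set splits into the part inside the sieves, bounded by the uniform
equipartition property, and the part outside, bounded through its expectation. -/
theorem ae_tendsto_posterior_zero {A : Set Θ} (hA : MeasurableSet A)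
    (h : M.hOn univ < M.hOn A) :
    ∀ᵐ ω ∂M.P, Tendsto (fun n => M.posterior n (M.data n ω) A) atTop (𝓝 0) := by
  obtain ⟨𝒢, h𝒢, -, ⟨a, ς, -, hς, hmass⟩, hunif, hinf, -⟩ := hM.sieves
  obtain ⟨c, hc1, hc2⟩ := ENNReal.lt_iff_exists_nnreal_btwn.1 h
  set h₀ : ℝ := (M.hOn univ).toReal with hh₀
  have hof : ENNReal.ofReal h₀ = M.hOn univ := ENNReal.ofReal_toReal hM.hOn_univ_ne_top
  have hnn : 0 ≤ h₀ := ENNReal.toReal_nonneg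
  have hh₀c : h₀ < c := by
    rwa [← hof, ← ENNReal.ofReal_coe_nnreal, ENNReal.ofReal_lt_ofReal_iff_of_nonneg hnn] at hc1
  have hh₀ς : h₀ < ς := by
    have h2 : 2 * M.hOn univ = ENNReal.ofReal (2 * h₀) := by
      rw [ENNReal.ofReal_mul zero_le_two, hof, ENNReal.ofReal_ofNat]
    rw [h2, ENNReal.ofReal_lt_ofReal_iff_of_nonneg (by positivity)] at hς
    linarith
  -- The numerator will decay at rate `s`, the normalizing constant at most at rate `b < s`.
  obtain ⟨s, hs1, hs2⟩ := exists_between (lt_min hh₀c hh₀ς)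
  obtain ⟨b, hb1, hb2⟩ := exists_between hs1
  have hsA : ENNReal.ofReal s < M.hOn A := by
    refine lt_of_le_of_lt ?_ hc2
    rw [← ENNReal.ofReal_coe_nnreal]
    exact ENNReal.ofReal_le_ofReal (hs2.trans_le (min_le_left _ _)).le
  have hbU : M.hOn univ < ENNReal.ofReal b := by
    rw [← hof, ENNReal.ofReal_lt_ofReal_iff_of_nonneg hnn]
    exact hb1
  have hout : ∀ n : ℕ, M.prior (𝒢 n)ᶜ ≤ ENNReal.ofReal (a * Real.exp (-ς * n)) := by
    intro n
    rw [← ofReal_measureReal (measure_ne_top _ _), probReal_compl_eq_one_sub (h𝒢 n)]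
    exact ENNReal.ofReal_le_ofReal (by linarith [hmass n])
  have hpos : ∀ᵐ ω ∂M.P, ∀ n, M.p n (M.data n ω) ≠ 0 := ae_all_iff.2 ae_data_p_ne_zero
  filter_upwards [hpos, hunif, hinf, hM.ae_eventually_le_setLIntegral_R MeasurableSet.univ hbU,
    hM.ae_eventually_setLIntegral_R_le (hs2.trans_le (min_le_right _ _)) hout]
    with ω hω hω1 hω2 hω3 hω4
  have hin := eventually_setLIntegral_inter_R_le h𝒢
    (fun ε hε => (hω1 ε hε).mono fun n hn θ hθ hθi => (hn θ hθ hθi).2) hω2 hA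
    (hnn.trans hs1.le) hsA
  have hlim : Tendsto (fun n : ℕ => ENNReal.ofReal (2 * Real.exp (-((s - b) * n))))
      atTop (𝓝 0) := by
    rw [← ENNReal.ofReal_zero]
    refine ENNReal.tendsto_ofReal ?_
    rw [← mul_zero (2 : ℝ)]
    exact (Real.tendsto_exp_neg_atTop_nhds_zero.comp
      (tendsto_natCast_atTop_atTop.const_mul_atTop (by linarith))).const_mul 2
  refine tendsto_of_tendsto_of_tendsto_of_le_of_le' tendsto_const_nhds hlim
    (Eventually.of_forall fun _ => zero_le) ?_
  filter_upwards [hω3, hω4, hin] with n hn3 hn4 hn5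
  rw [posterior_apply (hω n) hA]
  rw [setLIntegral_univ] at hn3
  have hsplit : ∫⁻ θ in A, M.R n θ (M.data n ω) ∂M.prior ≤
      ENNReal.ofReal (2 * Real.exp (-s * n)) := by
    calc _ ≤ ∫⁻ θ in (𝒢 n ∩ A) ∪ (𝒢 n)ᶜ, M.R n θ (M.data n ω) ∂M.prior :=
          lintegral_mono_set fun θ hθ => by
            by_cases hg : θ ∈ 𝒢 n
            · exact Or.inl ⟨hg, hθ⟩
            · exact Or.inr hg
      _ ≤ _ := lintegral_union_le _ _ _
      _ ≤ _ := add_le_add hn5 hn4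
      _ = _ := by
          rw [← ENNReal.ofReal_add (Real.exp_pos _).le (Real.exp_pos _).le, two_mul]
  calc _ ≤ (ENNReal.ofReal (Real.exp (-b * n)))⁻¹ * ENNReal.ofReal (2 * Real.exp (-s * n)) :=
        mul_le_mul' (ENNReal.inv_le_inv.2 hn3) hsplit
    _ = _ := by
        rw [← ENNReal.ofReal_inv_of_pos (Real.exp_pos _), ← Real.exp_neg,
          ← ENNReal.ofReal_mul (Real.exp_pos _).le, mul_left_comm, ← Real.exp_add]
        ring_nf

lemma ae_eventually_lintegral_R_ne_top :
    ∀ᵐ ω ∂M.P, ∀ᶠ n in atTop, ∫⁻ θ, M.R n θ (M.data n ω) ∂M.prior ≠ ∞ := by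
  have h := hM.ae_eventually_setLIntegral_R_le (A := fun _ => univ) (a := 1) (s := 0) (s' := -1)
    (by norm_num) (fun n => by simp)
  filter_upwards [h] with ω hω
  filter_upwards [hω] with n hn
  rw [setLIntegral_univ] at hn
  exact ne_top_of_le_ne_top ENNReal.ofReal_ne_top hn

/-- A set of finite divergence rate almost surely ends up with positive posterior probability. -/
lemma ae_eventually_posterior_real_pos {A : Set Θ} (hA : MeasurableSet A) (h : M.hOn A ≠ ∞) :
    ∀ᵐ ω ∂M.P, ∀ᶠ n in atTop, 0 < (M.posterior n (M.data n ω)).real A := by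
  have hc : M.hOn A < ENNReal.ofReal ((M.hOn A).toReal + 1) :=
    (ENNReal.lt_ofReal_iff_toReal_lt h).2 (by linarith)
  have hpos : ∀ᵐ ω ∂M.P, ∀ n, M.p n (M.data n ω) ≠ 0 := ae_all_iff.2 ae_data_p_ne_zero
  filter_upwards [hpos, hM.ae_eventually_lintegral_R_ne_top,
    hM.ae_eventually_le_setLIntegral_R hA hc] with ω hω h1 h2
  filter_upwards [h1, h2] with n hn1 hn2
  refine ENNReal.toReal_pos ?_ (measure_ne_top _ _)
  rw [posterior_apply (hω n) hA]
  refine mul_ne_zero (ENNReal.inv_ne_zero.2 hn1) ?_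
  exact (lt_of_lt_of_le (ENNReal.ofReal_pos.2 (Real.exp_pos _)) hn2).ne'

/-- The posterior is almost surely a genuine probability measure from some sample size on. -/
lemma ae_eventually_posterior_real_univ :
    ∀ᵐ ω ∂M.P, ∀ᶠ n in atTop, (M.posterior n (M.data n ω)).real univ = 1 := by
  have hpos : ∀ᵐ ω ∂M.P, ∀ n, M.p n (M.data n ω) ≠ 0 := ae_all_iff.2 ae_data_p_ne_zero
  filter_upwards [hpos, hM.ae_eventually_lintegral_R_ne_top,
    hM.ae_eventually_posterior_real_pos MeasurableSet.univ hM.hOn_univ_ne_top] with ω hω h1 h2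
  filter_upwards [h1, h2] with n hn1 hn2
  have h3 := posterior_apply (hω n) MeasurableSet.univ
  have h4 : M.posterior n (M.data n ω) univ ≠ 0 := fun h => by simp [Measure.real, h] at hn2
  rw [setLIntegral_univ] at h3
  rw [h3] at h4
  rw [Measure.real, h3, ENNReal.inv_mul_cancel (right_ne_zero_of_mul h4) hn1, ENNReal.toReal_one]

/-! ### Concentration on the true configuration -/

/-- If `h(A)` equals the minimal rate `h(Θ)`, then `J(A) = 0 = J(Θ)`; the subtraction in `J` loses
nothing because `h(Θ)` is finite. -/
lemma hOn_univ_lt_of_JOn_ne {A : Set Θ} (h : M.JOn A ≠ M.JOn univ) :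
    M.hOn univ < M.hOn A := by
  by_contra! hle
  have hac : M.prior.restrict A ≪ M.prior.restrict univ :=
    (Measure.restrict_mono (subset_univ A) le_rfl).absolutelyContinuous
  refine h (le_antisymm ?_ (essInf_antitone_measure hac))
  refine le_trans (le_of_not_gt fun hpos => ?_) (zero_le : 0 ≤ M.JOn univ)
  obtain ⟨ε, hε0, hε⟩ := exists_between hpos
  have h1 : M.hOn univ + ε ≤ M.hOn A := by
    refine le_essInf_of_ae_le _ ?_
    filter_upwards [ae_lt_of_lt_essInf (f := M.J) hε] with θ hθ
    have h2 := lt_tsub_iff_left.1 (hθ : ε < M.h θ - M.hOn univ)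
    exact h2.le
  exact (ENNReal.lt_add_right hM.hOn_univ_ne_top hε0.ne').not_ge (h1.trans hle)

theorem ae_tendsto_posterior_compl_configRegion {m : ℕ} {H : Fin m → Set Θ}
    (hH : ∀ i, MeasurableSet (H i)) {dt : Fin m → Bool}
    (hdt : ∀ d, M.JOn (configRegion H d) = M.JOn univ ↔ d = dt) :
    ∀ᵐ ω ∂M.P, Tendsto (fun n => (M.posterior n (M.data n ω)).real (configRegion H dt)ᶜ)
      atTop (𝓝 0) := by
  -- The complement is the finite union of the regions of the other configurations.
  have h1 : ∀ d : {d : Fin m → Bool // d ≠ dt}, ∀ᵐ ω ∂M.P,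
      Tendsto (fun n => M.posterior n (M.data n ω) (configRegion H d)) atTop (𝓝 0) := fun d =>
    hM.ae_tendsto_posterior_zero (measurableSet_configRegion hH d)
      (hM.hOn_univ_lt_of_JOn_ne fun h => d.2 ((hdt d).1 h))
  filter_upwards [ae_all_iff.2 h1] with ω hω
  have h2 := tendsto_finsetSum Finset.univ
    fun (d : {d : Fin m → Bool // d ≠ dt}) _ => hω d
  rw [Finset.sum_const_zero] at h2
  have h3 : Tendsto (fun n => M.posterior n (M.data n ω) (configRegion H dt)ᶜ) atTop (𝓝 0) := by
    refine tendsto_of_tendsto_of_tendsto_of_le_of_le tendsto_const_nhds h2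
      (fun _ => zero_le) fun n => ?_
    refine (measure_mono ?_).trans (measure_iUnion_fintype_le _ _)
    intro θ hθ
    classical
    refine mem_iUnion.2 ⟨⟨fun i => decide (θ ∉ H i), fun h => hθ ?_⟩, fun i => by simp⟩
    exact h ▸ fun i => by simp
  exact (ENNReal.continuousAt_toReal ENNReal.zero_ne_top).tendsto.comp h3

end Shalizi
end BayesMT.Model

namespace BayesMT.Model

variable {Ω Ξ Θ : Type*} [MeasurableSpace Ω] [MeasurableSpace Ξ] [MeasurableSpace Θ]
  {M : Model Ω Ξ Θ}

/-! ### Integrals of functions of the decision -/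

variable {m : ℕ} {H : Fin m → Set Θ} {G : Fin m → Finset (Fin m)}

/-- The modified posterior FDR of the configuration `d` given the data `x`. -/
noncomputable def configFDR (M : Model Ω Ξ Θ) (H : Fin m → Set Θ) (G : Fin m → Finset (Fin m))
    (n : ℕ) (d : Fin m → Bool) (x : Fin n → Ξ) : ℝ :=
  (∑ i, if d i = true then 1 - M.w H G n x d i else 0) /
    max (∑ i, if d i = true then (1 : ℝ) else 0) 1

lemma modifiedFDR_additiveProcedure (n : ℕ) (β : ℝ) (x : Fin n → Ξ) :
    M.modifiedFDR H G n x (M.additiveProcedure H n β x) =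
      M.configFDR H G n (M.additiveDecision H n β x) x := by
  simp [modifiedFDR, additiveProcedure, configFDR]

lemma configFDR_nonneg (n : ℕ) (d : Fin m → Bool) (x : Fin n → Ξ) :
    0 ≤ M.configFDR H G n d x := by
  refine div_nonneg (Finset.sum_nonneg fun i _ => ?_) (zero_le_one.trans (le_max_right _ _))
  split_ifs
  · exact sub_nonneg.2 (posterior_real_le_one _ _ _)
  · exact le_rfl

lemma configFDR_le_one (n : ℕ) (d : Fin m → Bool) (x : Fin n → Ξ) :
    M.configFDR H G n d x ≤ 1 := by
  refine div_le_one_of_le₀ (le_trans (Finset.sum_le_sum fun i _ => ?_) (le_max_left _ _))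
    (zero_le_one.trans (le_max_right _ _))
  split_ifs
  · exact sub_le_self _ measureReal_nonneg
  · exact le_rfl

lemma configFDR_false (n : ℕ) (x : Fin n → Ξ) :
    M.configFDR H G n (fun _ => false) x = 0 := by
  simp [configFDR]

lemma Shalizi.aemeasurable_configFDR (hM : M.Shalizi) (hH : ∀ i, MeasurableSet (H i)) (n : ℕ)
    (d : Fin m → Bool) : AEMeasurable (M.configFDR H G n d) (M.dataLaw n) := by
  have hw : ∀ i, AEMeasurable (fun x => M.w H G n x d i) (M.dataLaw n) := by
    intro i
    have hset : {θ | θ ∉ H i ∧ ∀ j ∈ G i, j ≠ i → (d j = true ↔ θ ∉ H j)} =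
        (H i)ᶜ ∩ ⋂ j ∈ G i, ⋂ _ : j ≠ i, if d j = true then (H j)ᶜ else H j := by
      ext θ
      simp only [mem_ofPred_eq, mem_inter_iff, mem_compl_iff, mem_iInter]
      refine and_congr_right fun _ => forall_congr' fun j => forall₂_congr fun _ _ => ?_
      cases d j <;> simp
    refine hM.aemeasurable_posterior_real n (hset ▸ (hH i).compl.inter ?_)
    refine MeasurableSet.iInter fun j => MeasurableSet.iInter fun _ => MeasurableSet.iInter
      fun _ => ?_
    split_ifs
    exacts [(hH j).compl, hH j]
  refine AEMeasurable.div_const (Finset.aemeasurable_fun_sum _ fun i _ => ?_) _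
  split_ifs
  · exact aemeasurable_const.sub (hw i)
  · exact aemeasurable_const

lemma Shalizi.aemeasurable_additiveDecision (hM : M.Shalizi) (hH : ∀ i, MeasurableSet (H i))
    (n : ℕ) (β : ℝ) : AEMeasurable (M.additiveDecision H n β) (M.dataLaw n) := by
  refine aemeasurable_pi_lambda _ fun i => ?_
  have hd : Measurable fun t : ℝ => decide (β < t) :=
    measurable_to_bool (by
      have : (fun t : ℝ => decide (β < t)) ⁻¹' {true} = Ioi β := by ext t; simp
      rw [this]
      exact measurableSet_Ioi)
  exact hd.comp_aemeasurable (hM.aemeasurable_posterior_real n (hH i).compl)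

lemma Shalizi.aemeasurable_comp_additiveDecision (hM : M.Shalizi)
    (hH : ∀ i, MeasurableSet (H i)) {n : ℕ} (β : ℝ) {g : (Fin m → Bool) → (Fin n → Ξ) → ℝ}
    (hg : ∀ d, AEMeasurable (g d) (M.dataLaw n)) :
    AEMeasurable (fun x => g (M.additiveDecision H n β x) x) (M.dataLaw n) := by
  have heval : Measurable fun q : (Fin m → Bool) × ((Fin m → Bool) → ℝ) => q.2 q.1 :=
    measurable_from_prod_countable_right fun d => measurable_pi_apply d
  exact heval.comp_aemeasurable ((hM.aemeasurable_additiveDecision hH n β).prodMk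
    (aemeasurable_pi_lambda _ hg))

/-- Bounded functions of the data that converge along almost every sequence of observations
converge in mean. -/
lemma tendsto_integral_of_ae_tendsto {F : ∀ n, (Fin n → Ξ) → ℝ} {c : ℝ}
    (hF : ∀ n, AEMeasurable (F n) (M.dataLaw n)) (hb : ∀ n x, ‖F n x‖ ≤ 1)
    (hlim : ∀ᵐ ω ∂M.P, Tendsto (fun n => F n (M.data n ω)) atTop (𝓝 c)) :
    Tendsto (fun n => ∫ x, F n x ∂M.dataLaw n) atTop (𝓝 c) := by
  have h1 : ∀ n, ∫ x, F n x ∂M.dataLaw n = ∫ ω, F n (M.data n ω) ∂M.P := fun n =>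
    integral_map (measurable_data n).aemeasurable (hF n).aestronglyMeasurable
  have h2 := tendsto_integral_of_dominated_convergence (μ := M.P) (f := fun _ => c)
    (F := fun n ω => F n (M.data n ω)) (fun _ => (1 : ℝ))
    (fun n => ((hF n).comp_measurable (measurable_data n)).aestronglyMeasurable)
    (integrable_const _) (fun n => ae_of_all _ fun ω => hb n _) hlim
  simpa [h1] using h2

/-- Integrals of bounded functions of the decision are continuous in the threshold where the
decision is almost surely locally constant. -/
lemma Shalizi.tendsto_integral_comp_additiveDecision (hM : M.Shalizi)
    (hH : ∀ i, MeasurableSet (H i)) {n : ℕ} {g : (Fin m → Bool) → (Fin n → Ξ) → ℝ}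
    (hg : ∀ d, AEMeasurable (g d) (M.dataLaw n)) (hb : ∀ d x, ‖g d x‖ ≤ 1) {β₀ : ℝ}
    {l : Filter ℝ} [l.IsCountablyGenerated]
    (hl : ∀ᵐ x ∂M.dataLaw n,
      ∀ᶠ β in l, M.additiveDecision H n β x = M.additiveDecision H n β₀ x) :
    Tendsto (fun β => ∫ x, g (M.additiveDecision H n β x) x ∂M.dataLaw n) l
      (𝓝 (∫ x, g (M.additiveDecision H n β₀ x) x ∂M.dataLaw n)) := by
  refine tendsto_integral_filter_of_dominated_convergence (fun _ => (1 : ℝ))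
    (Eventually.of_forall fun β =>
      (hM.aemeasurable_comp_additiveDecision hH β hg).aestronglyMeasurable)
    (Eventually.of_forall fun β => ae_of_all _ fun x => hb _ x) (integrable_const _) ?_
  filter_upwards [hl] with x hx
  refine tendsto_const_nhds.congr' ?_
  filter_upwards [hx] with β hβ
  rw [hβ]

lemma eventually_additiveDecision_eq {n : ℕ} {x : Fin n → Ξ} {β₀ : ℝ}
    (h : ∀ i, M.v H n x i ≠ β₀) :
    ∀ᶠ β in 𝓝 β₀, M.additiveDecision H n β x = M.additiveDecision H n β₀ x := by
  have h1 : ∀ i, ∀ᶠ β in 𝓝 β₀, (β < M.v H n x i ↔ β₀ < M.v H n x i) := by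
    intro i
    rcases lt_or_gt_of_ne (h i) with hi | hi
    · filter_upwards [lt_mem_nhds hi] with β hβ
      exact iff_of_false hβ.not_gt hi.not_gt
    · filter_upwards [gt_mem_nhds hi] with β hβ
      exact iff_of_true hβ hi
  filter_upwards [eventually_all.2 h1] with β hβ
  funext i
  simp [additiveDecision, hβ i]

lemma eventually_additiveDecision_eq_zero {n : ℕ} (x : Fin n → Ξ) :
    ∀ᶠ β in 𝓝[>] (0 : ℝ), M.additiveDecision H n β x = M.additiveDecision H n 0 x := by
  have h1 : ∀ i, ∀ᶠ β in 𝓝[>] (0 : ℝ), (β < M.v H n x i ↔ 0 < M.v H n x i) := by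
    intro i
    rcases (measureReal_nonneg : 0 ≤ M.v H n x i).eq_or_lt with hi | hi
    · filter_upwards [self_mem_nhdsWithin] with β hβ
      exact iff_of_false (not_lt.2 (hi.symm.le.trans (le_of_lt hβ))) (fun h => h.ne hi)
    · filter_upwards [nhdsWithin_le_nhds (gt_mem_nhds hi)] with β hβ
      exact iff_of_true hβ hi
  filter_upwards [eventually_all.2 h1] with β hβ
  funext i
  simp [additiveDecision, hβ i]

/-- The expected modified posterior FDR of the additive-loss procedure; it does not need the
conditioning, since the modified posterior FDR vanishes when nothing is rejected. -/
noncomputable def meanFDR (M : Model Ω Ξ Θ) (H : Fin m → Set Θ) (G : Fin m → Finset (Fin m))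
    (n : ℕ) (β : ℝ) : ℝ :=
  ∫ x, M.configFDR H G n (M.additiveDecision H n β x) x ∂M.dataLaw n

/-- The probability that the additive-loss procedure rejects some hypothesis. -/
noncomputable def rejectProb (M : Model Ω Ξ Θ) (H : Fin m → Set Θ) (n : ℕ) (β : ℝ) : ℝ :=
  (M.dataLaw n).real {x | M.additiveDecision H n β x ≠ fun _ => false}

lemma mpBFDR_additiveProcedure (n : ℕ) (β : ℝ) :
    M.mpBFDR H G n (M.additiveProcedure H n β) = M.meanFDR H G n β / M.rejectProb H n β := by
  have hs : {x | M.additiveProcedure H n β x (fun _ => false) = 0} =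
      {x | M.additiveDecision H n β x ≠ fun _ => false} := by
    ext x
    simp [additiveProcedure, eq_comm]
  rw [mpBFDR, hs, ProbabilityTheory.cond, integral_smul_measure, ENNReal.toReal_inv, smul_eq_mul,
    inv_mul_eq_div, setIntegral_eq_integral_of_forall_compl_eq_zero]
  · simp only [modifiedFDR_additiveProcedure]
    rfl
  · intro x hx
    have hx' : M.additiveDecision H n β x = fun _ => false := by simpa using hx
    rw [modifiedFDR_additiveProcedure, hx', configFDR_false]

lemma Shalizi.rejectProb_eq_integral (hM : M.Shalizi) (hH : ∀ i, MeasurableSet (H i))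
    (n : ℕ) (β : ℝ) : M.rejectProb H n β =
      ∫ x, (fun (d : Fin m → Bool) (_ : Fin n → Ξ) => if d = fun _ => false then (0 : ℝ) else 1)
        (M.additiveDecision H n β x) x ∂M.dataLaw n := by
  have hs : NullMeasurableSet {x | M.additiveDecision H n β x ≠ fun _ => false} (M.dataLaw n) :=
    (hM.aemeasurable_additiveDecision hH n β).nullMeasurable
      (measurableSet_singleton (fun _ => false)).compl
  have h1 : M.rejectProb H n β = ∫ x in {x | M.additiveDecision H n β x ≠ fun _ => false},
      (1 : ℝ) ∂M.dataLaw n := by simp [rejectProb]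
  rw [h1, ← integral_indicator₀ hs]
  refine integral_congr_ae (ae_of_all _ fun x => ?_)
  by_cases hx : M.additiveDecision H n β x = fun _ => false <;> simp [hx]

lemma rejectProb_antitone (n : ℕ) : Antitone (M.rejectProb H n) := by
  intro β₁ β₂ h
  refine measureReal_mono fun x hx h1 => hx ?_
  funext i
  have h2 := congrFun h1 i
  simp only [additiveDecision, decide_eq_false_iff_not, not_lt] at h2 ⊢
  exact h2.trans h

end BayesMT.Model

/-! ### Choosing the thresholds -/

/-- If the equation `φ n β = α` has arbitrarily small positive solutions for large `n`, then
solutions can be chosen to tend to `0`: take them close to the infimum of all solutions. -/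
lemma exists_seq_tendsto_zero_of_eventually_exists_eq {φ : ℕ → ℝ → ℝ} {α : ℝ}
    (h : ∀ ε ∈ Ioo (0 : ℝ) 1, ∀ᶠ n in atTop, ∃ β ∈ Ioc 0 ε, φ n β = α) :
    ∃ β : ℕ → ℝ, (∀ n, β n ∈ Ioo (0 : ℝ) 1) ∧ Tendsto β atTop (𝓝 0) ∧
      ∀ᶠ n in atTop, φ n (β n) = α := by
  have hchoice : ∀ n : ℕ, ∃ b ∈ Ioo (0 : ℝ) 1, (∃ b' ∈ Ioo (0 : ℝ) 1, φ n b' = α) →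
      φ n b = α ∧ ∀ b' ∈ Ioo (0 : ℝ) 1, φ n b' = α → b < b' + 1 / ((n : ℝ) + 1) := by
    intro n
    by_cases hn : ∃ b' ∈ Ioo (0 : ℝ) 1, φ n b' = α
    · obtain ⟨b₀, hb₀, hb₀α⟩ := hn
      have hne : {b | b ∈ Ioo (0 : ℝ) 1 ∧ φ n b = α}.Nonempty := ⟨b₀, hb₀, hb₀α⟩
      obtain ⟨b, hb, hlt⟩ := Real.lt_sInf_add_pos hne (Nat.one_div_pos_of_nat (α := ℝ) (n := n))
      refine ⟨b, hb.1, fun _ => ⟨hb.2, fun b' hb' hbα => hlt.trans_le ?_⟩⟩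
      gcongr
      exact csInf_le ⟨0, fun c hc => hc.1.1.le⟩ ⟨hb', hbα⟩
    · exact ⟨1 / 2, by norm_num, fun h' => absurd h' hn⟩
  choose β hβ hsol using hchoice
  refine ⟨β, hβ, ?_, ?_⟩
  · refine tendsto_order.2 ⟨fun a ha => Eventually.of_forall fun n => ha.trans (hβ n).1,
      fun ε hε => ?_⟩
    have hδ : min (ε / 2) (1 / 2) ∈ Ioo (0 : ℝ) 1 :=
      ⟨by positivity, (min_le_right _ _).trans_lt (by norm_num)⟩
    filter_upwards [h _ hδ, tendsto_one_div_add_atTop_nhds_zero_nat.eventually_lt_const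
      (half_pos hε)] with n ⟨b, hb, hbα⟩ hn
    have hb1 : b ∈ Ioo (0 : ℝ) 1 := ⟨hb.1, hb.2.trans_lt hδ.2⟩
    have := (hsol n ⟨b, hb1, hbα⟩).2 b hb1 hbα
    linarith [hb.2.trans (min_le_left _ _)]
  · filter_upwards [h (1 / 2) (by norm_num)] with n ⟨b, hb, hbα⟩
    exact (hsol n ⟨b, ⟨hb.1, hb.2.trans_lt (by norm_num)⟩, hbα⟩).1

namespace BayesMT.Model

variable {Ω Ξ Θ : Type*} [MeasurableSpace Ω] [MeasurableSpace Ξ] [MeasurableSpace Θ]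
  {M : Model Ω Ξ Θ} {m : ℕ} {H : Fin m → Set Θ} {G : Fin m → Finset (Fin m)}

/-! ### Limits of the posterior probabilities and of the error measure -/

lemma tendsto_v_of_null {dt : Fin m → Bool} {ω : Ω}
    (h : Tendsto (fun n => (M.posterior n (M.data n ω)).real (configRegion H dt)ᶜ) atTop (𝓝 0))
    {i : Fin m} (hi : dt i = false) :
    Tendsto (fun n => M.v H n (M.data n ω) i) atTop (𝓝 0) := by
  refine tendsto_of_tendsto_of_tendsto_of_le_of_le tendsto_const_nhds h
    (fun _ => measureReal_nonneg) fun n => measureReal_mono fun θ hθ hc => ?_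
  exact absurd ((hc i).2 hθ) (by simp [hi])

lemma tendsto_posterior_real_one (hH : ∀ i, MeasurableSet (H i)) {dt : Fin m → Bool} {ω : Ω}
    (h : Tendsto (fun n => (M.posterior n (M.data n ω)).real (configRegion H dt)ᶜ) atTop (𝓝 0))
    (h1 : ∀ᶠ n in atTop, (M.posterior n (M.data n ω)).real univ = 1) {A : Set Θ}
    (hA : configRegion H dt ⊆ A) :
    Tendsto (fun n => (M.posterior n (M.data n ω)).real A) atTop (𝓝 1) := by
  have h2 : Tendsto (fun n => 1 - (M.posterior n (M.data n ω)).real (configRegion H dt)ᶜ)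
      atTop (𝓝 1) := by simpa using h.const_sub 1
  refine tendsto_of_tendsto_of_tendsto_of_le_of_le' h2 tendsto_const_nhds ?_
    (Eventually.of_forall fun n => posterior_real_le_one _ _ _)
  filter_upwards [h1] with n hn
  rw [measureReal_compl (measurableSet_configRegion hH dt), hn, sub_sub_cancel]
  exact measureReal_mono hA

/-- When everything is rejected, the true nulls alone contribute their posterior probabilities. -/
lemma sum_null_le_configFDR (n : ℕ) (x : Fin n → Ξ) (dt : Fin m → Bool) :
    (∑ i, if dt i = false then 1 - M.v H n x i else 0) / m ≤
      M.configFDR H G n (fun _ => true) x := by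
  rcases Nat.eq_zero_or_pos m with rfl | hm
  · simp [configFDR]
  have hm1 : (1 : ℝ) ≤ m := by exact_mod_cast hm
  simp only [configFDR, if_true, Finset.sum_const, Finset.card_univ, Fintype.card_fin,
    nsmul_eq_mul, mul_one, max_eq_left hm1]
  refine div_le_div_of_nonneg_right (Finset.sum_le_sum fun i _ => ?_) (by positivity)
  split_ifs
  · exact sub_le_sub_left (measureReal_mono fun θ hθ => hθ.1) 1
  · exact sub_nonneg.2 (posterior_real_le_one _ _ _)

namespace Shalizi

variable (hM : M.Shalizi) (hH : ∀ i, MeasurableSet (H i)) {dt : Fin m → Bool}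
  (hdt : ∀ d, M.JOn (configRegion H d) = M.JOn univ ↔ d = dt)
include hM hH hdt

lemma ae_eventually_additiveDecision_eq {β : ℝ} (hβ : β ∈ Ioo (0 : ℝ) 1) :
    ∀ᵐ ω ∂M.P, ∀ᶠ n in atTop, M.additiveDecision H n β (M.data n ω) = dt := by
  filter_upwards [hM.ae_tendsto_posterior_compl_configRegion hH hdt,
    hM.ae_eventually_posterior_real_univ] with ω h0 h1
  have h2 : ∀ i, ∀ᶠ n in atTop, decide (β < M.v H n (M.data n ω) i) = dt i := by
    intro i
    cases hi : dt i
    · filter_upwards [(tendsto_v_of_null h0 hi).eventually_lt_const hβ.1] with n hn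
      simpa using hn.le
    · have hsub : configRegion H dt ⊆ (H i)ᶜ := fun θ hθ => (hθ i).1 hi
      filter_upwards [(tendsto_posterior_real_one hH h0 h1 hsub).eventually_const_lt hβ.2]
        with n hn
      exact decide_eq_true hn
  filter_upwards [eventually_all.2 h2] with n hn
  exact funext hn

lemma ae_tendsto_configFDR_true (G : Fin m → Finset (Fin m)) :
    ∀ᵐ ω ∂M.P, Tendsto (fun n => M.configFDR H G n dt (M.data n ω)) atTop (𝓝 0) := by
  filter_upwards [hM.ae_tendsto_posterior_compl_configRegion hH hdt,
    hM.ae_eventually_posterior_real_univ] with ω h0 h1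
  have h2 : ∀ i, Tendsto
      (fun n => if dt i = true then 1 - M.w H G n (M.data n ω) dt i else 0) atTop (𝓝 0) := by
    intro i
    split_ifs with hi
    · have hsub : configRegion H dt ⊆
          {θ | θ ∉ H i ∧ ∀ j ∈ G i, j ≠ i → (dt j = true ↔ θ ∉ H j)} :=
        fun θ hθ => ⟨(hθ i).1 hi, fun j _ _ => hθ j⟩
      have h3 := (tendsto_posterior_real_one hH h0 h1 hsub).const_sub 1
      rwa [sub_self] at h3
    · exact tendsto_const_nhds
  have h3 := (tendsto_finsetSum Finset.univ fun i _ => h2 i).div_const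
    (max (∑ i, if dt i = true then (1 : ℝ) else 0) 1)
  simpa [configFDR] using h3

lemma tendsto_meanFDR_zero (G : Fin m → Finset (Fin m)) {β : ℝ} (hβ : β ∈ Ioo (0 : ℝ) 1) :
    Tendsto (fun n => M.meanFDR H G n β) atTop (𝓝 0) := by
  refine tendsto_integral_of_ae_tendsto
    (fun n => hM.aemeasurable_comp_additiveDecision hH β (hM.aemeasurable_configFDR hH n))
    (fun n x => ?_) ?_
  · rw [Real.norm_of_nonneg (configFDR_nonneg _ _ _)]
    exact configFDR_le_one _ _ _
  · filter_upwards [hM.ae_tendsto_configFDR_true hH hdt G,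
      hM.ae_eventually_additiveDecision_eq hH hdt hβ] with ω h1 h2
    refine h1.congr' ?_
    filter_upwards [h2] with n hn
    rw [hn]

lemma tendsto_rejectProb_one (hne : dt ≠ fun _ => false) {β : ℝ} (hβ : β ∈ Ioo (0 : ℝ) 1) :
    Tendsto (fun n => M.rejectProb H n β) atTop (𝓝 1) := by
  simp only [hM.rejectProb_eq_integral hH]
  refine tendsto_integral_of_ae_tendsto (fun n => hM.aemeasurable_comp_additiveDecision hH β
    (g := fun d _ => if d = fun _ => false then (0 : ℝ) else 1) fun d => aemeasurable_const)
    (fun n x => by split_ifs <;> simp) ?_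
  filter_upwards [hM.ae_eventually_additiveDecision_eq hH hdt hβ] with ω h
  refine tendsto_const_nhds.congr' ?_
  filter_upwards [h] with n hn
  rw [hn, if_neg hne]

/-- At threshold `0` everything is rejected in the limit, because the alternatives have finite
divergence rate; then the modified posterior FDR is at least about the proportion of true nulls. -/
lemma eventually_lt_meanFDR_zero (G : Fin m → Finset (Fin m)) (hfin : ∀ i, M.hOn (H i)ᶜ ≠ ∞)
    {α : ℝ} (hα : α < (numNulls dt : ℝ) / m) :
    ∀ᶠ n in atTop, α < M.meanFDR H G n 0 := by
  set g : ∀ n, (Fin m → Bool) → (Fin n → Ξ) → ℝ := fun n d x =>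
    if d = fun _ => true then (∑ i, if dt i = false then 1 - M.v H n x i else 0) / (m : ℝ) else 0
    with hg
  have hg_le : ∀ n d x, g n d x ≤ M.configFDR H G n d x := by
    intro n d x
    simp only [hg]
    split_ifs with hd
    · exact hd ▸ sum_null_le_configFDR n x dt
    · exact configFDR_nonneg _ _ _
  have hg_nonneg : ∀ n d x, 0 ≤ g n d x := by
    intro n d x
    simp only [hg]
    split_ifs
    · refine div_nonneg (Finset.sum_nonneg fun i _ => ?_) (by positivity)
      split_ifs
      exacts [sub_nonneg.2 (posterior_real_le_one _ _ _), le_rfl]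
    · exact le_rfl
  have hg_norm : ∀ n d x, ‖g n d x‖ ≤ 1 := fun n d x => by
    rw [Real.norm_of_nonneg (hg_nonneg n d x)]
    exact (hg_le n d x).trans (configFDR_le_one _ _ _)
  have hg_meas : ∀ n d, AEMeasurable (g n d) (M.dataLaw n) := by
    intro n d
    simp only [hg]
    split_ifs
    · refine AEMeasurable.div_const (Finset.aemeasurable_fun_sum _ fun i _ => ?_) _
      split_ifs
      · exact aemeasurable_const.sub (hM.aemeasurable_posterior_real n (hH i).compl)
      · exact aemeasurable_const
    · exact aemeasurable_const
  have hlim : Tendsto (fun n => ∫ x, g n (M.additiveDecision H n 0 x) x ∂M.dataLaw n) atTop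
      (𝓝 ((numNulls dt : ℝ) / m)) := by
    refine tendsto_integral_of_ae_tendsto
      (fun n => hM.aemeasurable_comp_additiveDecision hH 0 (hg_meas n)) (fun n x => hg_norm _ _ _)
      ?_
    have hpos : ∀ᵐ ω ∂M.P, ∀ i, ∀ᶠ n in atTop, 0 < M.v H n (M.data n ω) i := ae_all_iff.2
      fun i => hM.ae_eventually_posterior_real_pos (hH i).compl (hfin i)
    filter_upwards [hpos, hM.ae_tendsto_posterior_compl_configRegion hH hdt] with ω h1 h2
    have h3 : ∀ i, Tendsto (fun n => if dt i = false then 1 - M.v H n (M.data n ω) i else 0) atTop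
        (𝓝 (if dt i = false then (1 : ℝ) else 0)) := by
      intro i
      split_ifs with hi
      · simpa using (tendsto_v_of_null h2 hi).const_sub 1
      · exact tendsto_const_nhds
    have h4 := (tendsto_finsetSum Finset.univ fun i _ => h3 i).div_const (m : ℝ)
    rw [Finset.sum_boole] at h4
    refine h4.congr' ?_
    filter_upwards [eventually_all.2 h1] with n hn
    have hd : M.additiveDecision H n 0 (M.data n ω) = fun _ => true :=
      funext fun i => decide_eq_true (hn i)
    simp only [hg, hd, if_true]
  filter_upwards [hlim.eventually_const_lt hα] with n hn
  refine hn.trans_le (integral_mono ?_ ?_ fun x => hg_le n _ x)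
  · exact Integrable.of_bound
      (hM.aemeasurable_comp_additiveDecision hH 0 (hg_meas n)).aestronglyMeasurable 1
      (ae_of_all _ fun x => hg_norm _ _ _)
  · refine Integrable.of_bound (hM.aemeasurable_comp_additiveDecision hH 0
      (hM.aemeasurable_configFDR hH n)).aestronglyMeasurable 1 (ae_of_all _ fun x => ?_)
    rw [Real.norm_of_nonneg (configFDR_nonneg _ _ _)]
    exact configFDR_le_one _ _ _

omit hdt in
lemma continuousAt_meanFDR {n : ℕ} {β₀ : ℝ}
    (hc : ∀ i, M.dataLaw n {x | M.v H n x i = β₀} = 0) :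
    ContinuousAt (M.meanFDR H G n) β₀ := by
  refine hM.tendsto_integral_comp_additiveDecision hH (hM.aemeasurable_configFDR hH n)
    (fun d x => ?_) ?_
  · rw [Real.norm_of_nonneg (configFDR_nonneg _ _ _)]
    exact configFDR_le_one _ _ _
  · filter_upwards [ae_all_iff.2 fun i => measure_eq_zero_iff_ae_notMem.1 (hc i)] with x hx
    exact eventually_additiveDecision_eq hx

omit hdt in
lemma continuousAt_rejectProb {n : ℕ} {β₀ : ℝ}
    (hc : ∀ i, M.dataLaw n {x | M.v H n x i = β₀} = 0) :
    ContinuousAt (M.rejectProb H n) β₀ := by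
  have h := hM.tendsto_integral_comp_additiveDecision hH (n := n) (β₀ := β₀) (l := 𝓝 β₀)
    (g := fun d _ => if d = fun _ => false then (0 : ℝ) else 1) (fun d => aemeasurable_const)
    (fun d x => by split_ifs <;> simp) (by
      filter_upwards [ae_all_iff.2 fun i => measure_eq_zero_iff_ae_notMem.1 (hc i)] with x hx
      exact eventually_additiveDecision_eq hx)
  simp only [← hM.rejectProb_eq_integral hH] at h
  exact h

omit hdt in
lemma tendsto_meanFDR_nhdsGT_zero (n : ℕ) :
    Tendsto (M.meanFDR H G n) (𝓝[>] 0) (𝓝 (M.meanFDR H G n 0)) := by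
  refine hM.tendsto_integral_comp_additiveDecision hH (hM.aemeasurable_configFDR hH n)
    (fun d x => ?_) (ae_of_all _ eventually_additiveDecision_eq_zero)
  rw [Real.norm_of_nonneg (configFDR_nonneg _ _ _)]
  exact configFDR_le_one _ _ _

/-- The intermediate value step: for large `n` the error measure exceeds `α` at tiny thresholds
and is below `α` at the fixed threshold `ε`. -/
lemma eventually_exists_mpBFDR_eq (G : Fin m → Finset (Fin m)) (hfin : ∀ i, M.hOn (H i)ᶜ ≠ ∞)
    (hcont : ∀ᶠ n in atTop, ∀ i, ∀ c ∈ Ioo (0 : ℝ) 1, M.dataLaw n {x | M.v H n x i = c} = 0)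
    (hne : dt ≠ fun _ => false) {α : ℝ} (hα₀ : 0 < α) (hα : α < (numNulls dt : ℝ) / m)
    {ε : ℝ} (hε : ε ∈ Ioo (0 : ℝ) 1) :
    ∀ᶠ n in atTop, ∃ β ∈ Ioc 0 ε, M.mpBFDR H G n (M.additiveProcedure H n β) = α := by
  have hquot : Tendsto (fun n => M.meanFDR H G n ε / M.rejectProb H n ε) atTop (𝓝 0) := by
    have h := (hM.tendsto_meanFDR_zero hH hdt G hε).div
      (hM.tendsto_rejectProb_one hH hdt hne hε) one_ne_zero
    rwa [zero_div] at h
  filter_upwards [hcont, hquot.eventually_lt_const hα₀,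
    (hM.tendsto_rejectProb_one hH hdt hne hε).eventually_const_lt one_pos,
    hM.eventually_lt_meanFDR_zero hH hdt G hfin hα] with n hn hεn hrej h0
  obtain ⟨b, hb, hb0, hbε⟩ : ∃ b, α < M.meanFDR H G n b ∧ 0 < b ∧ b < ε :=
    (((hM.tendsto_meanFDR_nhdsGT_zero hH n).eventually_const_lt h0).and
      (Ioo_mem_nhdsGT hε.1)).exists
  have hpos : ∀ β ≤ ε, 0 < M.rejectProb H n β := fun β hβ =>
    hrej.trans_le (rejectProb_antitone n hβ)
  have hcts : ContinuousOn (fun β => M.meanFDR H G n β / M.rejectProb H n β) (Icc b ε) := by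
    intro β hβ
    have hc : ∀ i, M.dataLaw n {x | M.v H n x i = β} = 0 := fun i =>
      hn i β ⟨hb0.trans_le hβ.1, hβ.2.trans_lt hε.2⟩
    exact ((hM.continuousAt_meanFDR hH hc).div (hM.continuousAt_rejectProb hH hc)
      (hpos β hβ.2).ne').continuousWithinAt
  have hbα : α ≤ M.meanFDR H G n b / M.rejectProb H n b := by
    rw [le_div_iff₀ (hpos b hbε.le)]
    exact (mul_le_of_le_one_right hα₀.le measureReal_le_one).trans hb.le
  obtain ⟨β, hβ, hβα⟩ := intermediate_value_Icc' hbε.le hcts ⟨hεn.le, hbα⟩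
  exact ⟨β, ⟨hb0.trans_le hβ.1, hβ.2⟩, (mpBFDR_additiveProcedure n β).trans hβα⟩

end Shalizi
end BayesMT.Model

theorem mainTheorem9 {Ω Ξ K : Type*} {T : K → Type*} {m : ℕ}
    [MeasurableSpace Ω] [MeasurableSpace Ξ] [MeasurableSpace (∀ k, T k)]
    (M : BayesMT.Model Ω Ξ (∀ k, T k)) (hM : M.Shalizi)
    -- the `i`-th null hypothesis says that the coordinate `idx i` of `θ` lies in `null i`
    (idx : Fin m ↪ K) (null : ∀ i : Fin m, Set (T (idx i)))
    (H : Fin m → Set (∀ k, T k)) (hH : ∀ i, H i = {θ | θ (idx i) ∈ null i})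
    (hmeas : ∀ i, MeasurableSet (H i))
    -- arbitrary groups
    (G : Fin m → Finset (Fin m)) (hG : ∀ i, i ∈ G i)
    -- `dt` is the true decision configuration
    (dt : Fin m → Bool)
    (hdt : ∀ d : Fin m → Bool, M.JOn (BayesMT.configRegion H d) = M.JOn Set.univ ↔ d = dt)
    -- the alternatives have finite divergence rate
    (hfin : ∀ i, M.hOn (H i)ᶜ ≠ ∞)
    -- the posterior probabilities of the alternatives have no atoms in `(0, 1)`
    (hcont : ∀ᶠ n in Filter.atTop, ∀ i, ∀ c ∈ Set.Ioo (0 : ℝ) 1,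
      M.dataLaw n {x | M.v H n x i = c} = 0)
    (hm₀ : BayesMT.numNulls dt < m)
    (α : ℝ) (hα₀ : 0 < α) (hα : α < (BayesMT.numNulls dt : ℝ) / (m : ℝ)) :
    ∃ β : ℕ → ℝ, (∀ n, β n ∈ Set.Ioo (0 : ℝ) 1) ∧
      Filter.Tendsto β Filter.atTop (𝓝 0) ∧
      Filter.Tendsto (fun n => M.mpBFDR H G n (M.additiveProcedure H n (β n)))
        Filter.atTop (𝓝 α) := by
  -- Some alternative is true, so the conditioning event has probability tending to `1`.
  have hne : dt ≠ fun _ => false := by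
    rintro rfl
    simp [BayesMT.numNulls] at hm₀
  obtain ⟨β, hβ, hβ0, hβα⟩ := exists_seq_tendsto_zero_of_eventually_exists_eq
    (φ := fun n β => M.mpBFDR H G n (M.additiveProcedure H n β)) fun ε hε =>
      hM.eventually_exists_mpBFDR_eq hmeas hdt G hfin hcont hne hα₀ hα hε
  refine ⟨β, hβ, hβ0, tendsto_const_nhds.congr' ?_⟩
  filter_upwards [hβα] with n hn
  exact hn.symm
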